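/- A ballean is a set $X$ with a family $\mathcal E$ of subsets of $X\times X$ (the ball structure, whose elements are called entourages) such that every $E\in\mathcal E$ contains the diagonal, for all $E,F\in\mathcal E$ some $D\in\mathcal E$ contains $E\circ F^{-1}=\{(x,z):\exists y\ (x,y)\in E,\ (z,y)\in F\}$, and $\bigcup\mathcal E=X\times X$. For $E\subseteq X\times X$, $x\in X$ and $A\subseteq X$ put $E[x]=\{y:(x,y)\in E\}$ and $E[A]=\bigcup_{a\in A}E[a]$. A set $B\subseteq X$ is bounded if $B\subseteq E[x]$ for some $E\in\mathcal E$, $x\in X$; the family of bounded sets is the bornology of $X$. A family of sets has a linearly ordered base if it has a subfamily that is linearly ordered by inclusion and cofinal in it with respect to inclusion. The ballean has bounded growth if there is $\Gamma\subseteq X\times X$ such that $\Gamma[B]$ is bounded for every bounded $B$, and for every $E\in\mathcal E$ there is a bounded $B$ with $E[x]\subseteq\Gamma[x]$ for all $x\in X\setminus B$. Sets $A,B\subseteq X$ are asymptotically disjoint if $E[A]\cap E[B]$ is bounded for every $E\in\mathcal E$; a set $U$ is an asymptotic neighborhood of $A$ if $E[A]\setminus U$ is bounded for every $E\in\mathcal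 E$. The ballean is normal if any two asymptotically disjoint sets have disjoint asymptotic neighborhoods. For a group $G$ and an infinite cardinal $\kappa$, let $[G]^{<\kappa}$ be the family of all subsets of $G$ of cardinality $<\kappa$, and let $\mathcal E_{[G]^{<\kappa}}$ be the ball structure on $G$ consisting of the entourages $\{(x,y)\in G\times G:y\in\{x\}\cup Ix\}$, $I\in[G]^{<\kappa}$. The bornology of the ballean $(G,\mathcal E_{[G]^{<\kappa}})$ is $[G]^{<\kappa}$. Theorem. Let $G$ be a group and $\kappa\le|G|$ an infinite cardinal. The following conditions are equivalent: 1. the ball structure $\mathcal E_{[G]^{<\kappa}}$ has a linearly ordered base; 2. the bornology $[G]^{<\kappa}$ of the ballean $(G,\mathcal E_{[G]^{<\kappa}})$ has a linearly ordered base; 3. the ballean $(G,\mathcal E_{[G]^{<\kappa}})$ has bounded growth; 4. $|G|=\kappa$ and $\kappa$ is a regular cardinal. If $\kappa$ is regular or $G$ is solvable, then conditions 1–4 are equivalent to 5. the ballean $(G,\mathcal E_{[G]^{<\kappa}})$ is normal. In particular, for any group $G$ (finite or infinite) the finitary ballean $(G,\mathcal E_{[G]^{<\aleph_0}})$ is normal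 if and only if $G$ is countable. -/

import Mathlib

/-- A ballean on `X`: a family of entourages of `X` (the ball structure) satisfying the three
axioms below. -/
structure Ballean (X : Type*) where
  /-- The ball structure. -/
  entourages : Set (SetRel X X)
  /-- Every entourage contains the diagonal. -/
  diag_mem : ∀ E ∈ entourages, ∀ x : X, (x, x) ∈ E
  /-- `E ∘ F⁻¹` is contained in an entourage, for all entourages `E`, `F`. -/
  comp_inv : ∀ E ∈ entourages, ∀ F ∈ entourages, ∃ D ∈ entourages, SetRel.comp E F.inv ⊆ D
  /-- The entourages cover `X × X`. -/
  sUnion_eq : ⋃₀ entourages = Set.univ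

namespace Ballean

/-- The ball `E[x]` of radius `E` centered at `x`. -/
def ball {X : Type*} (E : SetRel X X) (x : X) : Set X := {y | (x, y) ∈ E}

/-- A set is bounded if it is contained in some ball. -/
def IsBdd {X : Type*} (S : Ballean X) (B : Set X) : Prop :=
  ∃ E ∈ S.entourages, ∃ x : X, B ⊆ ball E x

/-- The bornology of a ballean: the family of all its bounded sets. -/
def bornology {X : Type*} (S : Ballean X) : Set (Set X) := {B | S.IsBdd B}

/-- `A` and `B` are asymptotically disjoint if `E[A] ∩ E[B]` is bounded for every entourage `E`;
here `E[A] = SetRel.image E A` is the union of the balls `E[a]`, `a ∈ A`. -/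
def AsympDisjoint {X : Type*} (S : Ballean X) (A B : Set X) : Prop :=
  ∀ E ∈ S.entourages, S.IsBdd (SetRel.image E A ∩ SetRel.image E B)

/-- `U` is an asymptotic neighborhood of `A` if `E[A] \ U` is bounded for every entourage `E`. -/
def IsAsympNhd {X : Type*} (S : Ballean X) (U A : Set X) : Prop :=
  ∀ E ∈ S.entourages, S.IsBdd (SetRel.image E A \ U)

/-- A ballean is normal if any two asymptotically disjoint sets have disjoint asymptotic
neighborhoods. -/
def IsNormal {X : Type*} (S : Ballean X) : Prop :=
  ∀ A B : Set X, S.AsympDisjoint A B →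
    ∃ U V : Set X, S.IsAsympNhd U A ∧ S.IsAsympNhd V B ∧ Disjoint U V

/-- A ballean has bounded growth if there is a set `Γ ⊆ X × X` such that `Γ[B]` is bounded for
every bounded `B`, and every entourage `E` satisfies `E[x] ⊆ Γ[x]` for all `x` outside some bounded
set. -/
def HasBoundedGrowth {X : Type*} (S : Ballean X) : Prop :=
  ∃ Γ : SetRel X X, (∀ B : Set X, S.IsBdd B → S.IsBdd (SetRel.image Γ B)) ∧
    ∀ E ∈ S.entourages, ∃ B : Set X, S.IsBdd B ∧ ∀ x : X, x ∉ B → ball E x ⊆ ball Γ x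

/-- A family of sets, partially ordered by inclusion, has a linearly ordered base if it has a
cofinal subfamily that is linearly ordered by inclusion. -/
def HasLinearlyOrderedBase {α : Type*} (P : Set (Set α)) : Prop :=
  ∃ C ⊆ P, IsChain (· ⊆ ·) C ∧ ∀ A ∈ P, ∃ B ∈ C, A ⊆ B

/-- The entourage `{(x, y) : y ∈ {x} ∪ Ix}` on a group `G` given by a set `I ⊆ G`. -/
def groupEntourage {G : Type*} [Group G] (I : Set G) : SetRel G G :=
  {p | p.2 = p.1 ∨ ∃ g ∈ I, p.2 = g * p.1}

/-- The ballean on the group `G` generated by the family of all subsets of `G` of cardinality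
less than the infinite cardinal `κ`. -/
def ofGroup (G : Type*) [Group G] (κ : Cardinal) (hκ : Cardinal.aleph0 ≤ κ) : Ballean G where
  entourages := {E | ∃ I : Set G, Cardinal.mk I < κ ∧ E = groupEntourage I}
  diag_mem := by
    rintro E ⟨I, -, rfl⟩ x
    exact Or.inl rfl
  comp_inv := by
    rintro E ⟨I, hI, rfl⟩ F ⟨J, hJ, rfl⟩
    have h1 : ∀ K : Set G, Cardinal.mk K < κ → Cardinal.mk (insert 1 K : Set G) < κ := fun K hK =>
      (Cardinal.mk_insert_le).trans_lt
        (Cardinal.add_lt_of_lt hκ hK (Cardinal.one_lt_aleph0.trans_le hκ))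
    refine ⟨_, ⟨Set.image2 (fun j i => j⁻¹ * i) (insert 1 J) (insert 1 I), ?_, rfl⟩, ?_⟩
    · have h2 : Cardinal.mk (Set.image2 (fun j i : G => j⁻¹ * i) (insert 1 J) (insert 1 I)) ≤
          Cardinal.mk (insert 1 J : Set G) * Cardinal.mk (insert 1 I : Set G) := by
        rw [← Set.image_uncurry_prod]
        exact Cardinal.mk_image_le.trans (Cardinal.mk_setProd _ _).le
      exact h2.trans_lt (Cardinal.mul_lt_of_lt hκ (h1 J hJ) (h1 I hI))
    · rintro ⟨x, z⟩ ⟨y, hxy, hzy⟩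
      have h3 : ∀ (K : Set G) (a b : G), (a, b) ∈ groupEntourage K →
          ∃ k ∈ insert 1 K, b = k * a := by
        rintro K a b (h | ⟨g, hg, h⟩)
        · exact ⟨1, Set.mem_insert _ _, by simpa using h⟩
        · exact ⟨g, Set.mem_insert_of_mem _ hg, h⟩
      obtain ⟨i, hi, h4⟩ := h3 I x y hxy
      obtain ⟨j, hj, h5⟩ := h3 J z y hzy
      refine Or.inr ⟨j⁻¹ * i, ⟨j, hj, i, hi, rfl⟩, ?_⟩
      change z = j⁻¹ * i * x
      rw [mul_assoc, ← h4, h5, inv_mul_cancel_left]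
  sUnion_eq := by
    refine Set.eq_univ_of_forall ?_
    rintro ⟨x, y⟩
    refine ⟨_, ⟨{y * x⁻¹}, ?_, rfl⟩, Or.inr ⟨y * x⁻¹, rfl, by simp⟩⟩
    rw [Cardinal.mk_singleton]
    exact Cardinal.one_lt_aleph0.trans_le hκ

/-- The bornology of this ballean is the family of all subsets of cardinality `< κ`. -/
theorem bornology_ofGroup (G : Type*) [Group G] (κ : Cardinal) (hκ : Cardinal.aleph0 ≤ κ) :
    (ofGroup G κ hκ).bornology = {B : Set G | Cardinal.mk B < κ} := by
  ext B
  constructor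
  · rintro ⟨E, ⟨I, hI, rfl⟩, x, hB⟩
    have h1 : B ⊆ insert x ((fun g => g * x) '' I) := by
      intro y hy
      rcases hB hy with h | ⟨g, hg, h⟩
      · exact Or.inl h
      · exact Or.inr ⟨g, hg, h.symm⟩
    exact ((Cardinal.mk_le_mk_of_subset h1).trans Cardinal.mk_insert_le).trans_lt
      (Cardinal.add_lt_of_lt hκ (Cardinal.mk_image_le.trans_lt hI)
        (Cardinal.one_lt_aleph0.trans_le hκ))
  · intro hB
    exact ⟨_, ⟨B, hB, rfl⟩, 1, fun y hy => Or.inr ⟨y, hy, by simp⟩⟩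

end Ballean

/-! Conditions 1–3 all say that `κ` many steps exhaust `G` while fewer than `κ` never do. If `|G| =
κ` is regular, a well-order of type `κ` gives everything: initial segments form a linear base, and
`Γ` may move `x` by every `g` not after `x`. Conversely, a chain base or a function `Γ` fails by
diagonalization when `κ < |G|` or `κ` is singular. A chain base also yields normality: the `I`-th
neighborhoods are built after deleting the few points that `I` can bring into a collision.

Non-normality has two sources. For singular `κ` in a solvable group, take the last derived subgroup
of size at least `κ`; its elements commute modulo the next one, which has size `< κ`. Two large
asymptotically disjoint sets `A`, `B` in it cannot be separated, since `ab` must lie near `B` and,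
as `[a,b]ba`, near `A` (`not_disjoint_asympNhds`).

For regular `κ < |G|`, fix a subgroup `H` of size `κ` and an independent sequence of pairs `k i`, `g
i` of length `κ⁺`. Let `B` be the set of all `k i` and `A` the union of the sets `(g i)⁻¹ M i`, with
large `M i ⊆ H (k i)`. Independence makes `A` and `B` asymptotically disjoint
(`index_eq_of_independent_pairs`). A neighborhood of `B` contains some whole coset `H (k i)`, and a
neighborhood of `A` contains almost all of `M i`, so they meet. -/

open Cardinal Set Pointwise

universe u

/-! ### Cardinal estimates, generated subgroups and transfinite recursion. -/

namespace Cardinal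

/-- Every cardinal is the cardinality of a well-ordered type with small initial segments. -/
theorem exists_wellOrder_mk_Iio_lt (κ : Cardinal.{u}) :
    ∃ (ι : Type u) (_ : LinearOrder ι) (_ : WellFoundedLT ι), #ι = κ ∧ ∀ i : ι, #(Iio i) < κ :=
  ⟨κ.ord.ToType, inferInstance, inferInstance, mk_ord_toType κ, fun i => by
    simpa using mk_Iio_lt i (by simp)⟩

theorem mk_Iic_lt_of_mk_Iio_lt {ι : Type u} [LinearOrder ι] {κ : Cardinal.{u}} (hκ : ℵ₀ ≤ κ) {i : ι}
    (hi : #(Iio i) < κ) : #(Iic i) < κ := by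
  rw [← Iio_insert]
  exact mk_insert_le.trans_lt (add_lt_of_lt hκ hi (one_lt_aleph0.trans_le hκ))

theorem mk_mul_lt {G : Type u} [Mul G] {κ : Cardinal.{u}} (hκ : ℵ₀ ≤ κ) {A B : Set G}
    (hA : #A < κ) (hB : #B < κ) : #(A * B : Set G) < κ :=
  mk_mul_le.trans_lt (mul_lt_of_lt hκ hA hB)

theorem mk_insert_lt {α : Type u} {κ : Cardinal.{u}} (hκ : ℵ₀ ≤ κ) {A : Set α} (a : α)
    (hA : #A < κ) : #(insert a A : Set α) < κ :=
  mk_insert_le.trans_lt (add_lt_of_lt hκ hA (one_lt_aleph0.trans_le hκ))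

theorem mk_union_lt {α : Type u} {κ : Cardinal.{u}} (hκ : ℵ₀ ≤ κ) {A B : Set α}
    (hA : #A < κ) (hB : #B < κ) : #(A ∪ B : Set α) < κ :=
  (mk_union_le A B).trans_lt (add_lt_of_lt hκ hA hB)

theorem mk_iUnion_le_of_le {α ι : Type u} {κ : Cardinal.{u}} (hκ : ℵ₀ ≤ κ) (hι : #ι ≤ κ)
    {t : ι → Set α} (ht : ∀ i, #(t i) ≤ κ) : #(⋃ i, t i) ≤ κ :=
  (mk_iUnion_le t).trans ((mul_le_mul' hι (ciSup_le' ht)).trans (mul_eq_self hκ).le)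

theorem IsRegular.mk_iUnion_lt {α ι : Type u} {κ : Cardinal.{u}} (hκ : κ.IsRegular) (hι : #ι < κ)
    {t : ι → Set α} (ht : ∀ i, #(t i) < κ) : #(⋃ i, t i) < κ :=
  (card_iUnion_lt_iff_forall_of_isRegular hκ hι).2 ht

theorem exists_mem_sdiff_of_mk_lt {α : Type u} {A B : Set α} (h : #A < #B) : ∃ x ∈ B, x ∉ A := by
  by_contra! hc
  exact h.not_ge (mk_le_mk_of_subset hc)

theorem exists_notMem_of_mk_lt {α : Type u} {A : Set α} (h : #A < #α) : ∃ x, x ∉ A := by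
  rw [← mk_univ (α := α)] at h
  obtain ⟨x, -, hx⟩ := exists_mem_sdiff_of_mk_lt h
  exact ⟨x, hx⟩

/-- A type whose cardinality is a singular cardinal is a union of few small sets. -/
theorem exists_cover_of_not_isRegular {α : Type u} (hκ : ℵ₀ ≤ #α) (hr : ¬ (#α).IsRegular) :
    ∃ (ι : Type u) (S : ι → Set α), #ι < #α ∧ (∀ i, #(S i) < #α) ∧ ∀ x, ∃ i, x ∈ S i := by
  obtain ⟨e⟩ : Nonempty ((#α).ord.ToType ≃ α) := by
    rw [← Cardinal.eq]; exact mk_ord_toType _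
  obtain ⟨s, hs, hs'⟩ := Order.exists_cof_eq (α := (#α).ord.ToType)
  refine ⟨s, fun i => e '' Iic i.1, ?_, ?_, ?_⟩
  · rw [hs', Ordinal.cof_toType]
    by_contra! h
    exact hr ⟨hκ, h⟩
  · intro i
    refine mk_image_le.trans_lt (mk_Iic_lt_of_mk_Iio_lt hκ ?_)
    simpa using mk_Iio_lt i.1 (by simp)
  · intro x
    obtain ⟨y, hy, hxy⟩ := hs (e.symm x)
    exact ⟨⟨y, hy⟩, e.symm x, hxy, by simp⟩

end Cardinal

theorem Subgroup.mk_closure_le {G : Type u} [Group G] {κ : Cardinal.{u}} (hκ : ℵ₀ ≤ κ) {S : Set G}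
    (hS : #S ≤ κ) : #(Subgroup.closure S) ≤ κ := by
  rcases S.eq_empty_or_nonempty with rfl | hne
  · rw [Subgroup.closure_empty]
    have : #(⊥ : Subgroup G) = 1 := by rw [Cardinal.eq_one_iff_unique]; constructor <;> infer_instance
    rw [this]
    exact one_le_aleph0.trans hκ
  · have := hne.to_subtype
    have h := FreeGroup.closure_eq_range S
    rw [h]
    refine (mk_range_le (f := FreeGroup.lift (Subtype.val : S → G))).trans ?_
    rw [mk_freeGroup]
    exact max_le hS hκ

/-- Transfinite recursion in which the requirement on each term depends on the set of previous
terms. -/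
theorem exists_transfinite_seq {ι X : Type u} [LinearOrder ι] [WellFoundedLT ι]
    (R : ι → Set X → X → Prop) (h : ∀ i (S : Set X), #S ≤ #(Iio i) → ∃ x, R i S x) :
    ∃ f : ι → X, ∀ i, R i (f '' Iio i) (f i) := by
  have h' : ∀ i (S : Set X), ∃ x, #S ≤ #(Iio i) → R i S x := by
    intro i S
    by_cases hS : #S ≤ #(Iio i)
    · obtain ⟨x, hx⟩ := h i S hS
      exact ⟨x, fun _ => hx⟩
    -- Junk value: `F` must be total, and the recursion never reaches sets this large.
    · obtain ⟨x, -⟩ := h i ∅ (by simp)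
      exact ⟨x, fun hS' => (hS hS').elim⟩
  choose F hF using h'
  let f : ι → X := (wellFounded_lt (α := ι)).fix
    fun i IH => F i (range fun j : Iio i => IH j.1 j.2)
  refine ⟨f, fun i => ?_⟩
  have hfi : f i = F i (f '' Iio i) := by
    rw [image_eq_range]
    exact (wellFounded_lt (α := ι)).fix_eq _ i
  rw [hfi]
  exact hF i _ mk_image_le

namespace Ballean

/-! ### Linearly ordered bases of the family of sets of size `< κ`. -/

section LinearBase

variable {α : Type u} {κ : Cardinal.{u}}

/-- Pick a chain member `D x` around each `x`, and `T` of size `κ`. As `D x` is too small to contain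
`T`, it misses some `t ∈ T`; then `D t` is not inside `D x`, so `x ∈ D t`. Thus `κ` small sets cover
everything. -/
theorem mk_eq_of_hasLinearlyOrderedBase (hκ : ℵ₀ ≤ κ) (hα : κ ≤ #α)
    (h : HasLinearlyOrderedBase {B : Set α | #B < κ}) : #α = κ := by
  obtain ⟨C, hC, hchain, hcof⟩ := h
  refine le_antisymm ?_ hα
  obtain ⟨T, hT⟩ := le_mk_iff_exists_set.1 hα
  have hsing : ∀ x : α, ∃ B ∈ C, x ∈ B := by
    intro x
    obtain ⟨B, hB, hxB⟩ := hcof {x} (by simpa using one_lt_aleph0.trans_le hκ)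
    exact ⟨B, hB, hxB rfl⟩
  choose D hDC hD using hsing
  have hcov : (⋃ t : T, D t) = Set.univ := by
    refine eq_univ_of_forall fun x => ?_
    obtain ⟨t, ht, htx⟩ := exists_mem_sdiff_of_mk_lt ((hC (hDC x)).trans_eq hT.symm)
    rcases hchain.total (hDC t) (hDC x) with hle | hle
    · exact (htx (hle (hD t))).elim
    · exact mem_iUnion.2 ⟨⟨t, ht⟩, hle (hD x)⟩
  rw [← mk_univ, ← hcov]
  exact mk_iUnion_le_of_le hκ hT.le fun t => (hC (hDC t)).le

/-- In the singular case, enlarge the few covering sets to chain members `D i` and choose `x i ∉ D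
i`. A chain member containing all `x i` lies in no `D i`, hence contains them all, hence is
everything. -/
theorem isRegular_of_hasLinearlyOrderedBase (hκ : ℵ₀ ≤ #α)
    (h : HasLinearlyOrderedBase {B : Set α | #B < #α}) : (#α).IsRegular := by
  obtain ⟨C, hC, hchain, hcof⟩ := h
  by_contra hr
  obtain ⟨ι, S, hι, hS, hcov⟩ := exists_cover_of_not_isRegular hκ hr
  choose D hDC hD using fun i => hcof (S i) (hS i)
  choose x hx using fun i => exists_notMem_of_mk_lt (hC (hDC i))
  obtain ⟨B, hB, hxB⟩ := hcof (range x) (mk_range_le.trans_lt hι)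
  obtain ⟨y, hy⟩ := exists_notMem_of_mk_lt (hC hB)
  obtain ⟨i, hi⟩ := hcov y
  rcases hchain.total hB (hDC i) with hle | hle
  · exact hx i (hle (hxB ⟨i, rfl⟩))
  · exact hy (hle (hD i hi))

theorem hasLinearlyOrderedBase_of_isRegular (hr : (#α).IsRegular) :
    HasLinearlyOrderedBase {B : Set α | #B < #α} := by
  obtain ⟨ι, _, _, hι, hlt⟩ := exists_wellOrder_mk_Iio_lt #α
  obtain ⟨e⟩ := Cardinal.eq.1 hι
  refine ⟨range fun i => e '' Iic i, ?_, ?_, ?_⟩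
  · rintro _ ⟨i, rfl⟩
    exact mk_image_le.trans_lt (mk_Iic_lt_of_mk_Iio_lt hr.aleph0_le (hlt i))
  · rintro _ ⟨i, rfl⟩ _ ⟨j, rfl⟩ -
    rcases le_total i j with h | h
    · exact Or.inl (image_mono (Iic_subset_Iic.2 h))
    · exact Or.inr (image_mono (Iic_subset_Iic.2 h))
  · intro A hA
    have hU : #(⋃ a : A, Iio (e.symm a)) < #ι := by
      rw [hι]
      exact hr.mk_iUnion_lt hA fun a => hlt _
    obtain ⟨i, hi⟩ := exists_notMem_of_mk_lt hU
    refine ⟨_, ⟨i, rfl⟩, fun a ha => ⟨e.symm a, ?_, by simp⟩⟩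
    by_contra hc
    exact hi (mem_iUnion.2 ⟨⟨a, ha⟩, not_le.1 hc⟩)

end LinearBase

/-! ### The group ballean: bounded growth, and normality from a linear base. -/

section Group

variable {G : Type u} [Group G] {κ : Cardinal.{u}} (hκ : ℵ₀ ≤ κ)

theorem isBdd_ofGroup {B : Set G} : (ofGroup G κ hκ).IsBdd B ↔ #B < κ :=
  Set.ext_iff.1 (bornology_ofGroup G κ hκ) B

theorem image_groupEntourage (I A : Set G) :
    SetRel.image (groupEntourage I) A = insert 1 I * A := by
  ext y
  constructor
  · rintro ⟨a, ha, hy | ⟨g, hg, hy⟩⟩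
    · exact ⟨1, Or.inl rfl, a, ha, by simpa using hy.symm⟩
    · exact ⟨g, Or.inr hg, a, ha, hy.symm⟩
  · rintro ⟨g, rfl | hg, a, ha, rfl⟩
    · exact ⟨a, ha, Or.inl (one_mul a)⟩
    · exact ⟨a, ha, Or.inr ⟨g, hg, rfl⟩⟩

theorem groupEntourage_mono {I J : Set G} (h : I ⊆ J) : groupEntourage I ⊆ groupEntourage J := by
  rintro p (hp | ⟨g, hg, hp⟩)
  · exact Or.inl hp
  · exact Or.inr ⟨g, h hg, hp⟩

theorem asympDisjoint_ofGroup {A B : Set G} :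
    (ofGroup G κ hκ).AsympDisjoint A B ↔
      ∀ I : Set G, #I < κ → #((I * A) ∩ (I * B) : Set G) < κ := by
  constructor
  · intro h I hI
    have := (isBdd_ofGroup hκ).1 (h _ ⟨I, hI, rfl⟩)
    rw [image_groupEntourage, image_groupEntourage] at this
    refine (mk_le_mk_of_subset ?_).trans_lt this
    exact inter_subset_inter (mul_subset_mul_right (subset_insert _ _))
      (mul_subset_mul_right (subset_insert _ _))
  · rintro h E ⟨I, hI, rfl⟩
    rw [isBdd_ofGroup, image_groupEntourage, image_groupEntourage]
    exact h _ (mk_insert_lt hκ 1 hI)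

theorem isAsympNhd_ofGroup {U A : Set G} :
    (ofGroup G κ hκ).IsAsympNhd U A ↔ ∀ I : Set G, #I < κ → #((I * A) \ U : Set G) < κ := by
  constructor
  · intro h I hI
    have := (isBdd_ofGroup hκ).1 (h _ ⟨I, hI, rfl⟩)
    rw [image_groupEntourage] at this
    refine (mk_le_mk_of_subset ?_).trans_lt this
    exact sdiff_subset_sdiff_left (mul_subset_mul_right (subset_insert _ _))
  · rintro h E ⟨I, hI, rfl⟩
    rw [isBdd_ofGroup, image_groupEntourage]
    exact h _ (mk_insert_lt hκ 1 hI)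

theorem ball_groupEntourage_one (I : Set G) : ball (groupEntourage I) 1 = insert 1 I := by
  ext y
  simp [ball, groupEntourage]

/-- Bases transfer along two monotone maps: `E ↦ ball E 1` and `I ↦ groupEntourage I`. -/
theorem hasLinearlyOrderedBase_entourages_iff :
    HasLinearlyOrderedBase (ofGroup G κ hκ).entourages ↔
      HasLinearlyOrderedBase {B : Set G | #B < κ} := by
  constructor
  · rintro ⟨C, hC, hchain, hcof⟩
    refine ⟨(fun E => ball E 1) '' C, ?_, ?_, ?_⟩
    · rintro _ ⟨E, hE, rfl⟩
      obtain ⟨I, hI, rfl⟩ := hC hE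
      change #(ball (groupEntourage I) 1) < κ
      rw [ball_groupEntourage_one]
      exact mk_insert_lt hκ 1 hI
    · rintro _ ⟨E, hE, rfl⟩ _ ⟨F, hF, rfl⟩ -
      rcases hchain.total hE hF with h | h
      · exact Or.inl fun y hy => h hy
      · exact Or.inr fun y hy => h hy
    · intro A hA
      obtain ⟨E, hE, hAE⟩ := hcof _ ⟨A, hA, rfl⟩
      exact ⟨_, ⟨E, hE, rfl⟩, fun y hy => hAE (Or.inr ⟨y, hy, by simp⟩)⟩
  · rintro ⟨C, hC, hchain, hcof⟩
    refine ⟨groupEntourage '' C, ?_, ?_, ?_⟩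
    · rintro _ ⟨I, hI, rfl⟩
      exact ⟨I, hC hI, rfl⟩
    · rintro _ ⟨I, hI, rfl⟩ _ ⟨J, hJ, rfl⟩ -
      rcases hchain.total hI hJ with h | h
      · exact Or.inl (groupEntourage_mono h)
      · exact Or.inr (groupEntourage_mono h)
    · rintro _ ⟨A, hA, rfl⟩
      obtain ⟨B, hB, hAB⟩ := hcof A hA
      exact ⟨_, ⟨B, hB, rfl⟩, groupEntourage_mono hAB⟩

theorem hasBoundedGrowth_of_isRegular (hG : #G = κ) (hr : κ.IsRegular) :
    (ofGroup G κ hκ).HasBoundedGrowth := by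
  obtain ⟨ι, _, _, hι, hlt⟩ := exists_wellOrder_mk_Iio_lt κ
  obtain ⟨e⟩ := Cardinal.eq.1 (hG.trans hι.symm)
  refine ⟨{p | ∃ g, e g ≤ e p.1 ∧ p.2 = g * p.1}, fun B hB => ?_, ?_⟩
  · rw [isBdd_ofGroup] at hB ⊢
    have hsub : SetRel.image {p : G × G | ∃ g, e g ≤ e p.1 ∧ p.2 = g * p.1} B ⊆
        ⋃ b : B, (fun i => e.symm i * b.1) '' Iic (e b.1) := by
      rintro y ⟨b, hb, g, hg, hy⟩
      exact mem_iUnion.2 ⟨⟨b, hb⟩, e g, hg, by simpa using hy.symm⟩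
    exact (mk_le_mk_of_subset hsub).trans_lt
      (hr.mk_iUnion_lt hB fun b => mk_image_le.trans_lt (mk_Iic_lt_of_mk_Iio_lt hκ (hlt _)))
  · rintro _ ⟨I, hI, rfl⟩
    -- The exceptional set consists of the points preceding some element of `I` or `1`; the latter
    -- is needed because the entourage contains the diagonal.
    refine ⟨⋃ i : (insert 1 I : Set G), e ⁻¹' Iio (e i), ?_, fun x hx => ?_⟩
    · rw [isBdd_ofGroup]
      refine hr.mk_iUnion_lt (mk_insert_lt hκ 1 hI) fun i => ?_
      rw [mk_preimage_equiv]
      exact hlt _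
    · have hle : ∀ i ∈ insert 1 I, e i ≤ e x := fun i hi => by
        by_contra hc
        exact hx (mem_iUnion.2 ⟨⟨i, hi⟩, not_le.1 hc⟩)
      rintro y (hy | ⟨g, hg, hy⟩)
      · exact ⟨1, hle 1 (mem_insert _ _), by simpa using hy⟩
      · exact ⟨g, hle g (mem_insert_of_mem _ hg), hy⟩

/-- Take `g i` outside `Γ[T i] (T i)⁻¹`. Since `g i` moves `T i` out of `Γ[T i]`, a bounded set off
which `Γ` dominates the entourage of all the `g i` must contain every `T i`. -/
theorem mk_iUnion_lt_of_entourages_subset {Γ : SetRel G G}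
    (hΓ : ∀ E ∈ (ofGroup G κ hκ).entourages, ∃ B : Set G, (ofGroup G κ hκ).IsBdd B ∧
      ∀ x : G, x ∉ B → ball E x ⊆ ball Γ x)
    {ι : Type u} (hι : #ι < κ) (T : ι → Set G)
    (hT : ∀ i, #(SetRel.image Γ (T i) * (T i)⁻¹ : Set G) < #G) : #(⋃ i, T i) < κ := by
  choose g hg using fun i => exists_notMem_of_mk_lt (hT i)
  obtain ⟨B, hB, hBΓ⟩ := hΓ _ ⟨range g, mk_range_le.trans_lt hι, rfl⟩
  refine (mk_le_mk_of_subset (iUnion_subset fun i x hx => ?_)).trans_lt ((isBdd_ofGroup hκ).1 hB)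
  by_contra hxB
  have hmem : g i * x ∈ SetRel.image Γ (T i) :=
    ⟨x, hx, hBΓ x hxB (Or.inr ⟨g i, ⟨i, rfl⟩, rfl⟩)⟩
  exact hg i ⟨_, hmem, x⁻¹, inv_mem_inv.2 hx, by simp⟩

/-- The preceding estimate is contradicted by a single set of size `κ` when `κ < |G|`, and by a
cover of `G` by few small sets when `κ` is singular. -/
theorem mk_eq_and_isRegular_of_hasBoundedGrowth (hG : κ ≤ #G)
    (h : (ofGroup G κ hκ).HasBoundedGrowth) : #G = κ ∧ κ.IsRegular := by
  obtain ⟨Γ, hΓ, hE⟩ := h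
  simp only [isBdd_ofGroup] at hΓ
  have hGκ : #G = κ := by
    refine le_antisymm ?_ hG
    by_contra! hlt
    obtain ⟨T, hT⟩ := le_mk_iff_exists_set.1 hG
    have h1 : #(SetRel.image Γ T) ≤ κ := by
      have hsub : SetRel.image Γ T ⊆ ⋃ t : T, SetRel.image Γ {t.1} := by
        rintro y ⟨t, ht, hy⟩
        exact mem_iUnion.2 ⟨⟨t, ht⟩, t, rfl, hy⟩
      refine (mk_le_mk_of_subset hsub).trans (mk_iUnion_le_of_le hκ hT.le fun t => ?_)
      exact (hΓ _ (by simpa using one_lt_aleph0.trans_le hκ)).le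
    have := mk_iUnion_lt_of_entourages_subset hκ hE (ι := PUnit)
      (by simpa using one_lt_aleph0.trans_le hκ) (fun _ => T) fun _ => by
        refine mk_mul_le.trans_lt (LE.le.trans_lt ?_ hlt)
        rw [mk_inv, hT]
        exact (mul_le_mul' h1 le_rfl).trans (mul_eq_self hκ).le
    rw [iUnion_const, hT] at this
    exact this.false
  refine ⟨hGκ, ?_⟩
  by_contra hr
  subst hGκ
  obtain ⟨ι, S, hι, hS, hcov⟩ := exists_cover_of_not_isRegular hκ hr
  have := mk_iUnion_lt_of_entourages_subset hκ hE hι S fun i =>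
    mk_mul_lt hκ (hΓ _ (hS i)) (by rw [mk_inv]; exact hS i)
  rw [(eq_univ_of_forall fun x => mem_iUnion.2 (hcov x) : (⋃ i, S i) = Set.univ), mk_univ] at this
  exact this.false

/-- If `ia = jb` with `i ∈ I ⊆ J` and `j ∈ J`, this point lies in `D J`, so `b` was deleted at stage
`J`. The deletions cost each `I * A` only the small set `I * (I⁻¹ * D I)`. -/
theorem isNormal_of_hasLinearlyOrderedBase
    (h : HasLinearlyOrderedBase {B : Set G | #B < κ}) : (ofGroup G κ hκ).IsNormal := by
  obtain ⟨C, hC, hchain, hcof⟩ := h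
  intro A B hAB
  rw [asympDisjoint_ofGroup] at hAB
  let D : Set G → Set G := fun I => (I * A) ∩ (I * B)
  have hnhd : ∀ A : Set G, (ofGroup G κ hκ).IsAsympNhd (⋃ I : C, I.1 * (A \ (I.1⁻¹ * D I.1))) A := by
    intro A
    rw [isAsympNhd_ofGroup]
    intro J hJ
    obtain ⟨I, hI, hJI⟩ := hcof J hJ
    have hsub : (J * A) \ (⋃ I : C, I.1 * (A \ (I.1⁻¹ * D I.1))) ⊆ I * (I⁻¹ * D I) := by
      rintro _ ⟨⟨g, hg, a, ha, rfl⟩, hn⟩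
      refine ⟨g, hJI hg, a, ?_, rfl⟩
      by_contra hc
      exact hn (mem_iUnion.2 ⟨⟨I, hI⟩, g, hJI hg, a, ⟨ha, hc⟩, rfl⟩)
    have hI' : #I < κ := hC hI
    exact (mk_le_mk_of_subset hsub).trans_lt
      (mk_mul_lt hκ hI' (mk_mul_lt hκ (by rwa [mk_inv]) (hAB I hI')))
  refine ⟨_, _, hnhd A, hnhd B, ?_⟩
  rw [Set.disjoint_left]
  rintro x hx hx'
  obtain ⟨⟨I, hI⟩, i, hi, a, ⟨ha, haD⟩, rfl⟩ := mem_iUnion.1 hx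
  obtain ⟨⟨J, hJ⟩, j, hj, b, ⟨hb, hbD⟩, hx⟩ := mem_iUnion.1 hx'
  dsimp only at *
  rcases hchain.total hI hJ with hIJ | hJI
  · refine hbD ⟨j⁻¹, inv_mem_inv.2 hj, i * a, ⟨⟨i, hIJ hi, a, ha, rfl⟩, j, hj, b, hb, hx⟩, ?_⟩
    simp [← hx]
  · refine haD ⟨i⁻¹, inv_mem_inv.2 hi, i * a, ⟨⟨i, hi, a, ha, rfl⟩, j, hJI hj, b, hb, hx⟩, ?_⟩
    simp

end Group
end Ballean

/-! ### Singular `κ` in solvable groups. -/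

/-- A large subset of a group contains two large sets whose nontrivial quotients are distinct. -/
theorem exists_sets_inv_mul_ne {G : Type u} [Group G] {κ : Cardinal.{u}} (hκ : ℵ₀ ≤ κ) {M : Set G}
    (hM : κ ≤ #M) : ∃ A ⊆ M, ∃ B ⊆ M, #A = κ ∧ #B = κ ∧
      ∀ a ∈ A, ∀ a' ∈ A, ∀ b ∈ B, ∀ b' ∈ B, a⁻¹ * a' = b⁻¹ * b' → a = a' := by
  obtain ⟨ι, _, _, hι, hlt⟩ := exists_wellOrder_mk_Iio_lt κ
  obtain ⟨s, hs⟩ := exists_transfinite_seq (ι := ι)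
    (fun _ S x => x ∈ M ∧ x ∉ S * S⁻¹ * S) (fun i S hS => by
      have hS' := hS.trans_lt (hlt i)
      obtain ⟨x, hx, hx'⟩ := exists_mem_sdiff_of_mk_lt
        ((mk_mul_lt hκ (mk_mul_lt hκ hS' ((mk_inv S).trans_lt hS')) hS').trans_le hM)
      exact ⟨x, hx, hx'⟩)
  have hgen : ∀ i j k l, j < i → k < i → l < i → s i ≠ s j * (s k)⁻¹ * s l :=
    fun i j k l hj hk hl h => (hs i).2 ⟨_, ⟨s j, ⟨j, hj, rfl⟩, (s k)⁻¹,
      inv_mem_inv.2 ⟨k, hk, rfl⟩, rfl⟩, s l, ⟨l, hl, rfl⟩, h.symm⟩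
  have hinj : Function.Injective s := by
    intro i j hij
    by_contra hne
    rcases lt_or_gt_of_ne hne with h | h
    · exact hgen j i i i h h h (by simp [hij])
    · exact hgen i j j j h h h (by simp [hij])
  obtain ⟨e⟩ : Nonempty (ι ⊕ ι ≃ ι) := by
    rw [← Cardinal.eq, ← add_def, hι, add_eq_self hκ]
  have hl : Function.Injective fun i => s (e (Sum.inl i)) :=
    hinj.comp (e.injective.comp Sum.inl_injective)
  have hr : Function.Injective fun i => s (e (Sum.inr i)) :=
    hinj.comp (e.injective.comp Sum.inr_injective)
  refine ⟨range fun i => s (e (Sum.inl i)), ?_, range fun i => s (e (Sum.inr i)), ?_,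
    (mk_range_eq _ hl).trans hι, (mk_range_eq _ hr).trans hι, ?_⟩
  · rintro _ ⟨i, rfl⟩
    exact (hs _).1
  · rintro _ ⟨i, rfl⟩
    exact (hs _).1
  rintro _ ⟨a, rfl⟩ _ ⟨a', rfl⟩ _ ⟨b, rfl⟩ _ ⟨b', rfl⟩ h
  by_contra hne
  have hab : ∀ i j, e (Sum.inl i) ≠ e (Sum.inr j) := fun i j hij => by simpa using e.injective hij
  have haa : e (Sum.inl a) ≠ e (Sum.inl a') := fun hh => hne (by simp only [hh])
  have hbb : e (Sum.inr b) ≠ e (Sum.inr b') := fun hh => by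
    simp only [hh, inv_mul_cancel] at h
    exact hne (inv_mul_eq_one.1 h)
  have h1 := hab a b
  have h2 := hab a b'
  have h3 := hab a' b
  have h4 := hab a' b'
  simp only at h
  generalize e (Sum.inl a) = a at *
  generalize e (Sum.inl a') = a' at *
  generalize e (Sum.inr b) = b at *
  generalize e (Sum.inr b') = b' at *
  have e1 : s a' = s a * (s b)⁻¹ * s b' := by rw [mul_assoc, ← h]; group
  have e2 : s b' = s b * (s a)⁻¹ * s a' := by rw [mul_assoc, h]; group
  have e3 : s a = s a' * (s b')⁻¹ * s b := by rw [e1]; group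
  have e4 : s b = s b' * (s a')⁻¹ * s a := by rw [e2]; group
  -- The four indices are distinct, and the relation expresses each term through the other three, so
  -- the largest index contradicts the choice of `s`.
  have : (a < a' ∧ b < a' ∧ b' < a') ∨ (b < b' ∧ a < b' ∧ a' < b') ∨
      (a' < a ∧ b' < a ∧ b < a) ∨ (b' < b ∧ a' < b ∧ a < b) := by
    grind
  rcases this with ⟨x, y, z⟩ | ⟨x, y, z⟩ | ⟨x, y, z⟩ | ⟨x, y, z⟩
  · exact hgen _ _ _ _ x y z e1
  · exact hgen _ _ _ _ x y z e2
  · exact hgen _ _ _ _ x y z e3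
  · exact hgen _ _ _ _ x y z e4

namespace Ballean

variable {G : Type u} [Group G] {κ : Cardinal.{u}} (hκ : ℵ₀ ≤ κ)

/-- A point `x = ia = jb` is determined by `(i, j)`: for two points with the same pair, `x⁻¹y` is a
quotient both in `A` and in `B`. So there are at most `|I × I|` points. -/
theorem asympDisjoint_of_inv_mul_ne {A B : Set G}
    (h : ∀ a ∈ A, ∀ a' ∈ A, ∀ b ∈ B, ∀ b' ∈ B, a⁻¹ * a' = b⁻¹ * b' → a = a') :
    (ofGroup G κ hκ).AsympDisjoint A B := by
  rw [asympDisjoint_ofGroup]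
  intro I hI
  choose i hi a ha hia using fun x : ((I * A) ∩ (I * B) : Set G) => x.2.1
  choose j hj b hb hjb using fun x : ((I * A) ∩ (I * B) : Set G) => x.2.2
  simp only at hia hjb
  have hinj : Function.Injective fun x => ((⟨i x, hi x⟩ : I), (⟨j x, hj x⟩ : I)) := by
    intro x y hxy
    simp only [Prod.mk.injEq, Subtype.mk.injEq] at hxy
    have h1 : (a x)⁻¹ * a y = x.1⁻¹ * y.1 := by rw [← hia x, ← hia y, hxy.1]; group
    have h2 : (b x)⁻¹ * b y = x.1⁻¹ * y.1 := by rw [← hjb x, ← hjb y, hxy.2]; group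
    have h3 := h _ (ha x) _ (ha y) _ (hb x) _ (hb y) (h1.trans h2.symm)
    exact Subtype.ext (by rw [← hia x, ← hia y, hxy.1, h3])
  refine (mk_le_of_injective hinj).trans_lt ?_
  rw [← mul_def]
  exact mul_lt_of_lt hκ hI hI

/-- For singular `κ`, two sets of size at least `κ` that commute modulo a small set have no disjoint
asymptotic neighborhoods. -/
theorem not_disjoint_asympNhds {A B N U V : Set G} (hA : #A = κ) (hB : κ ≤ #B) (hN : #N < κ)
    (hr : ¬ κ.IsRegular) (hAB : ∀ a ∈ A, ∀ b ∈ B, a * b * (b * a)⁻¹ ∈ N)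
    (hU : (ofGroup G κ hκ).IsAsympNhd U A) (hV : (ofGroup G κ hκ).IsAsympNhd V B) :
    ¬ Disjoint U V := by
  rw [isAsympNhd_ofGroup] at hU hV
  subst hA
  obtain ⟨ι, S, hι, hS, hcov⟩ := exists_cover_of_not_isRegular hκ hr
  have hS' : ∀ i, #((↑) '' S i : Set G) < #A := fun i => mk_image_le.trans_lt (hS i)
  -- Each small piece `S i` of `A` gets one `b i` with `S i * b i` inside `V`.
  have hex : ∀ i, ∃ b ∈ B, ∀ a ∈ S i, a.1 * b ∈ V := by
    intro i
    obtain ⟨b, hb, hb'⟩ := exists_mem_sdiff_of_mk_lt ((mk_mul_lt hκ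
      ((mk_inv _).trans_lt (hS' i)) (hV _ (hS' i))).trans_le hB)
    refine ⟨b, hb, fun a ha => ?_⟩
    by_contra hc
    have ha' : a.1 ∈ ((↑) '' S i : Set G) := ⟨a, ha, rfl⟩
    exact hb' ⟨a.1⁻¹, inv_mem_inv.2 ha', a * b, ⟨⟨a, ha', b, hb, rfl⟩, hc⟩, by simp⟩
  choose b hbB hbV using hex
  have hJ : #(N * range b : Set G) < #A := mk_mul_lt hκ hN (mk_range_le.trans_lt hι)
  -- There are few `b i`, so `N * range b` is small and some `a ∈ A` is sent into `U` by all of it.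
  -- If `a ∈ S i`, then `a * b i` lies in both `U` and `V`.
  obtain ⟨a, ha, ha'⟩ := exists_mem_sdiff_of_mk_lt
    (mk_mul_lt hκ ((mk_inv _).trans_lt hJ) (hU _ hJ))
  obtain ⟨i, hi⟩ := hcov ⟨a, ha⟩
  refine fun hd => Set.disjoint_left.1 hd ?_ (hbV i _ hi)
  by_contra hc
  have hmem : a * b i * (b i * a)⁻¹ * b i ∈ N * range b := ⟨_, hAB a ha _ (hbB i), _, ⟨i, rfl⟩, rfl⟩
  exact ha' ⟨_, inv_mem_inv.2 hmem, a * b i, ⟨⟨_, hmem, a, ha, by group⟩, hc⟩, by group⟩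

theorem not_isNormal_of_isSolvable [Group.IsSolvable G] (hG : κ ≤ #G) (hr : ¬ κ.IsRegular) :
    ¬ (ofGroup G κ hκ).IsNormal := by
  classical
  have hex : ∃ n, #(derivedSeries G n) < κ := by
    obtain ⟨n, hn⟩ := Group.IsSolvable.solvable (G := G)
    refine ⟨n, ?_⟩
    rw [hn, mk_eq_one]
    exact one_lt_aleph0.trans_le hκ
  -- `m` is the last stage before the derived series first becomes small.
  obtain ⟨m, hm⟩ : ∃ m, Nat.find hex = m + 1 := by
    refine Nat.exists_eq_succ_of_ne_zero fun h0 => ?_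
    have := Nat.find_spec hex
    rw [h0, derivedSeries_zero, mk_congr Subgroup.topEquiv.toEquiv] at this
    exact this.not_ge hG
  have hM : κ ≤ #(derivedSeries G m : Set G) := not_lt.1 (Nat.find_min hex (by omega))
  have hN : #(derivedSeries G (m + 1) : Set G) < κ := hm ▸ Nat.find_spec hex
  obtain ⟨A, hAM, B, hBM, hA, hB, hAB⟩ := exists_sets_inv_mul_ne hκ hM
  intro hnorm
  obtain ⟨U, V, hU, hV, hUV⟩ := hnorm A B (asympDisjoint_of_inv_mul_ne hκ hAB)
  refine not_disjoint_asympNhds hκ hA hB.ge hN hr (fun a ha b hb => ?_) hU hV hUV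
  have := Subgroup.commutator_mem_commutator (hAM ha) (hBM hb)
  rw [← derivedSeries_succ] at this
  rwa [commutatorElement_def, show a * b * a⁻¹ * b⁻¹ = a * b * (b * a)⁻¹ by group] at this

end Ballean
-- Regular `κ` smaller than `|G|`.
section Regular

variable {G : Type u} [Group G] {κ : Cardinal.{u}}

/-- If the distinct left translates of `P` have small intersections, then a set which is invariant
under many left translations is not covered by few left translates of `P`. -/
theorem not_subset_mul_union_of_thin (hr : κ.IsRegular) {H F P S Z : Set G} (hH : κ ≤ #H)
    (hF : κ ≤ #F) (hHF : ∀ h ∈ H, ∀ x ∈ F, h * x ∈ F)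
    (hP : ∀ c : G, c ≠ 1 → #((c • P) ∩ P : Set G) < κ) (hS : #S < κ) (hZ : #Z < κ) :
    ¬ F ⊆ S * P ∪ Z := by
  intro hcov
  have hκ := hr.aleph0_le
  -- Choose `h ∈ H` with `hc ∉ S`. Then `h(cP ∩ F)` stays in `F`, so it is covered by `Z` and the
  -- translates `sP`, each meeting `hcP` in a small set. Hence `F` itself would be small.
  have hsmall : ∀ c : S, #((c.1 • P) ∩ F : Set G) < κ := by
    rintro ⟨c, hc⟩
    have h1 : #(S * {c⁻¹} : Set G) < κ :=
      mk_mul_lt hκ hS (by simpa using one_lt_aleph0.trans_le hκ)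
    obtain ⟨h, hh, hhS⟩ := exists_mem_sdiff_of_mk_lt (h1.trans_le hH)
    have hsub : h • ((c • P) ∩ F) ⊆ (⋃ s : S, s.1 • (((s.1⁻¹ * (h * c)) • P) ∩ P)) ∪ Z := by
      rintro _ ⟨_, ⟨⟨p, hp, rfl⟩, hxF⟩, rfl⟩
      rcases hcov (hHF h hh _ hxF) with ⟨s, hs, q, hq, hsq⟩ | hz
      · refine Or.inl (mem_iUnion.2 ⟨⟨s, hs⟩, q, ⟨⟨p, hp, ?_⟩, hq⟩, hsq⟩)
        simp only [smul_eq_mul] at hsq ⊢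
        rw [mul_assoc, mul_assoc, ← hsq]
        group
      · exact Or.inr hz
    rw [← mk_smul_set h]
    refine (mk_le_mk_of_subset hsub).trans_lt (mk_union_lt hκ (hr.mk_iUnion_lt hS ?_) hZ)
    rintro ⟨s, hs⟩
    rw [mk_smul_set]
    refine hP _ fun hsc => hhS ⟨s, hs, c⁻¹, rfl, ?_⟩
    rw [inv_mul_eq_one] at hsc
    simp only at hsc ⊢
    rw [hsc, mul_inv_cancel_right]
  refine ((mk_le_mk_of_subset ?_).trans_lt
    (mk_union_lt hκ (hr.mk_iUnion_lt hS hsmall) hZ)).not_ge hF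
  intro x hx
  rcases hcov hx with ⟨s, hs, q, hq, rfl⟩ | hz
  · exact Or.inl (mem_iUnion.2 ⟨⟨s, hs⟩, ⟨q, hq, rfl⟩, hx⟩)
  · exact Or.inr hz

/-- A set invariant under many left translations contains a large subset whose left translates
have small intersections with a given thin set. -/
theorem exists_subset_forall_mk_smul_inter_lt (hr : κ.IsRegular) {H F P : Set G} (hH : κ ≤ #H)
    (hF : #F = κ) (hHF : ∀ h ∈ H, ∀ x ∈ F, h * x ∈ F)
    (hP : ∀ c : G, c ≠ 1 → #((c • P) ∩ P : Set G) < κ) (hPκ : #P ≤ κ) :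
    ∃ M ⊆ F, #M = κ ∧ ∀ c : G, #((c • M) ∩ P : Set G) < κ := by
  have hκ := hr.aleph0_le
  obtain ⟨ι, _, _, hι, hlt⟩ := exists_wellOrder_mk_Iio_lt κ
  have hT : #(P * F⁻¹ : Set G) ≤ #ι := by
    rw [hι]
    exact mk_mul_le.trans ((mul_le_mul' hPκ ((mk_inv F).trans hF).le).trans (mul_eq_self hκ).le)
  obtain ⟨e⟩ := hT
  -- Only translations in `P * F⁻¹` can move a point of `F` into `P`. They are enumerated in type
  -- `κ` (value `1` off the enumeration), and `m i` avoids the sets `(c j)⁻¹ P` for `j < i`.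
  let c : ι → G := Function.extend e (↑) 1
  have hc : ∀ t ∈ P * F⁻¹, ∃ i, c i = t := fun t ht => ⟨e ⟨t, ht⟩, e.injective.extend_apply _ _ _⟩
  obtain ⟨m, hm⟩ := exists_transfinite_seq (ι := ι)
    (fun i S x => x ∈ F ∧ x ∉ ((fun j => (c j)⁻¹) '' Iio i) * P ∪ S) (fun i S hS =>
      not_subset.1 (not_subset_mul_union_of_thin hr hH hF.ge hHF hP
        (mk_image_le.trans_lt (hlt i)) (hS.trans_lt (hlt i))))
  have hinj : Function.Injective m := by
    intro i j hij
    by_contra hne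
    rcases lt_or_gt_of_ne hne with h | h
    · exact (hm j).2 (Or.inr ⟨i, h, hij⟩)
    · exact (hm i).2 (Or.inr ⟨j, h, hij.symm⟩)
  refine ⟨range m, ?_, (mk_range_eq m hinj).trans hι, fun g => ?_⟩
  · rintro _ ⟨i, rfl⟩
    exact (hm i).1
  rcases ((g • range m) ∩ P).eq_empty_or_nonempty with h0 | ⟨_, ⟨_, ⟨i, rfl⟩, rfl⟩, hi⟩
  · rw [h0, mk_eq_zero]
    exact hr.pos
  obtain ⟨j, hj⟩ := hc g ⟨_, hi, (m i)⁻¹, inv_mem_inv.2 (hm i).1, by simp⟩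
  refine (mk_le_mk_of_subset ?_).trans_lt
    ((mk_image_le (f := fun l => g • m l)).trans_lt (mk_Iic_lt_of_mk_Iio_lt hκ (hlt j)))
  rintro _ ⟨⟨_, ⟨l, rfl⟩, rfl⟩, hl⟩
  refine ⟨l, ?_, rfl⟩
  by_contra hc
  exact (hm l).2 (Or.inl ⟨g⁻¹, ⟨j, not_le.1 hc, by simp [hj]⟩, _, hl, by simp⟩)

/-- A sequence whose terms are independent over an increasing chain of subgroups is thin. -/
theorem finite_smul_range_inter_range {W : Type u} [LinearOrder W] {k : W → G}
    {L : W → Subgroup G} (hL : ∀ i, k i ∉ L i) (hL' : ∀ i j, i < j → k i ∈ L j) {c : G}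
    (hc : c ≠ 1) : ((c • range k) ∩ range k).Finite := by
  rcases ((c • range k) ∩ range k).eq_empty_or_nonempty with
    h0 | ⟨_, ⟨_, ⟨j, rfl⟩, rfl⟩, ⟨i, hij⟩⟩
  · rw [h0]
    exact finite_empty
  -- A solution with smaller maximum puts `c` into `L (max i j)`, and then the later of `k i`, `k j`
  -- falls into its own forbidden subgroup. So all solutions share one maximum, which leaves two
  -- possible points.
  have key : ∀ i j i' j', k i = c • k j → k i' = c • k j' → max i j ≤ max i' j' := by
    intro i j i' j' h h'
    have hne : i ≠ j := by
      rintro rfl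
      rw [smul_eq_mul, right_eq_mul] at h
      exact hc h
    by_contra! hlt
    rw [max_lt_iff] at hlt
    have hcm : c ∈ L (max i j) := by
      have : c = k i' * (k j')⁻¹ := by rw [h', smul_eq_mul, mul_inv_cancel_right]
      rw [this]
      exact mul_mem (hL' _ _ hlt.1) (inv_mem (hL' _ _ hlt.2))
    rcases lt_or_gt_of_ne hne with hlt' | hlt'
    · rw [max_eq_right hlt'.le] at hcm
      refine hL j ?_
      have : k j = c⁻¹ * k i := by rw [h, smul_eq_mul, inv_mul_cancel_left]
      rw [this]
      exact mul_mem (inv_mem hcm) (hL' _ _ hlt')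
    · rw [max_eq_left hlt'.le] at hcm
      refine hL i ?_
      rw [h]
      exact mul_mem hcm (hL' _ _ hlt')
  refine Set.Finite.subset (toFinite {k (max i j), c • k (max i j)}) ?_
  rintro _ ⟨⟨_, ⟨j', rfl⟩, rfl⟩, ⟨i', hij'⟩⟩
  have hmax := le_antisymm (key _ _ _ _ hij hij') (key _ _ _ _ hij' hij)
  rw [hmax]
  rcases max_choice i' j' with h | h
  · rw [h]
    exact Or.inl hij'.symm
  · rw [h]
    exact Or.inr rfl

/-- Every stage has at most `κ` generators, so the subgroup generated is smaller than `G` and both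
new elements exist. -/
theorem exists_independent_pairs (hκ : ℵ₀ ≤ κ) (hG : κ < #G) {W : Type u} [LinearOrder W]
    [WellFoundedLT W] (hW : ∀ i : W, #(Iio i) ≤ κ) (H : Subgroup G) (hH : #H ≤ κ) :
    ∃ (k g : W → G) (L L' : W → Subgroup G), (∀ i, H ≤ L i) ∧ (∀ i, L i ≤ L' i) ∧
      (∀ i, k i ∉ L i) ∧ (∀ i, k i ∈ L' i) ∧ (∀ i, g i ∉ L' i) ∧
      (∀ i j, i < j → L' i ≤ L j) ∧ (∀ i j, i < j → g i ∈ L j) := by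
  let base : Set (G × G) → Set G := fun S => H ∪ (Prod.fst '' S ∪ Prod.snd '' S)
  have hbase : ∀ S : Set (G × G), #S ≤ κ → #(base S) ≤ κ := fun S hS =>
    (mk_union_le _ _).trans (add_le_of_le hκ hH ((mk_union_le _ _).trans
      (add_le_of_le hκ (mk_image_le.trans hS) (mk_image_le.trans hS))))
  obtain ⟨x, hx⟩ := exists_transfinite_seq (ι := W) (X := G × G)
    (fun _ S x => x.1 ∉ Subgroup.closure (base S) ∧
      x.2 ∉ Subgroup.closure (insert x.1 (base S))) (fun i S hS => by
        have hS' := hbase S (hS.trans (hW i))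
        obtain ⟨k, hk⟩ := exists_notMem_of_mk_lt
          (A := (Subgroup.closure (base S) : Set G)) ((Subgroup.mk_closure_le hκ hS').trans_lt hG)
        have hS'' : #(insert k (base S) : Set G) ≤ κ :=
          mk_insert_le.trans (add_le_of_le hκ hS' (one_le_aleph0.trans hκ))
        obtain ⟨g, hg⟩ := exists_notMem_of_mk_lt
          (A := (Subgroup.closure (insert k (base S)) : Set G))
          ((Subgroup.mk_closure_le hκ hS'').trans_lt hG)
        exact ⟨(k, g), hk, hg⟩)
  have hprev : ∀ i j, i < j → base (x '' Iio i) ⊆ base (x '' Iio j) := fun i j hij => by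
    have := image_mono (f := x) (Iio_subset_Iio hij.le)
    exact union_subset_union_right _ (union_subset_union (image_mono this) (image_mono this))
  refine ⟨fun i => (x i).1, fun i => (x i).2, fun i => Subgroup.closure (base (x '' Iio i)),
    fun i => Subgroup.closure (insert (x i).1 (base (x '' Iio i))), fun i => ?_, fun i => ?_,
    fun i => (hx i).1, fun i => ?_, fun i => (hx i).2, fun i j hij => ?_, fun i j hij => ?_⟩
  · exact fun h hh => Subgroup.subset_closure (Or.inl hh)
  · exact Subgroup.closure_mono (subset_insert _ _)
  · exact Subgroup.subset_closure (mem_insert _ _)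
  · refine Subgroup.closure_mono (insert_subset ?_ (hprev i j hij))
    exact Or.inr (Or.inl ⟨_, ⟨i, hij, rfl⟩, rfl⟩)
  · exact Subgroup.subset_closure (Or.inr (Or.inr ⟨_, ⟨i, hij, rfl⟩, rfl⟩))

/-- Eliminating `c` gives `k j * m⁻¹ * g i = k j' * m'⁻¹ * g i'`. If some `k`-index exceeded all
others, that `k` would lie in its `L` (`bound`); so a `g`-index is maximal, and were it not shared,
that `g` would lie in its `L'` (`top`). -/
theorem index_eq_of_independent_pairs {W : Type u} [LinearOrder W] {k g : W → G}
    {L L' : W → Subgroup G} {M : W → Set G} (hLL' : ∀ i, L i ≤ L' i) (hkL : ∀ i, k i ∉ L i)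
    (hkL' : ∀ i, k i ∈ L' i) (hgL' : ∀ i, g i ∉ L' i) (hL'L : ∀ i j, i < j → L' i ≤ L j)
    (hgL : ∀ i j, i < j → g i ∈ L j) (hM : ∀ i, M i ⊆ L' i) {c : G} {i i' j j' : W} {m m' : G}
    (hm : m ∈ M i) (hm' : m' ∈ M i') (h : c * ((g i)⁻¹ * m) = k j)
    (h' : c * ((g i')⁻¹ * m') = k j') (hne : j ≠ j') : i = i' ∧ j ≤ i := by
  have hc : k j * m⁻¹ * g i = k j' * m'⁻¹ * g i' := by rw [← h, ← h']; group
  clear h h'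
  have bound : ∀ {i i' j j' : W} {m m' : G}, m ∈ M i → m' ∈ M i' →
      k j * m⁻¹ * g i = k j' * m'⁻¹ * g i' → j' < j → i < j → i' < j → False := by
    intro i i' j j' m m' hm hm' hc hj hi hi'
    refine hkL j ?_
    have : k j = k j' * m'⁻¹ * g i' * (g i)⁻¹ * m := by rw [← hc]; group
    rw [this]
    exact mul_mem (mul_mem (mul_mem (mul_mem (hL'L _ _ hj (hkL' _))
      (inv_mem (hL'L _ _ hi' (hM _ hm')))) (hgL _ _ hi')) (inv_mem (hgL _ _ hi)))
      (hL'L _ _ hi (hM _ hm))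
  have mono : ∀ {i j : W}, i ≤ j → L' i ≤ L' j := fun {i j} hij => by
    rcases hij.eq_or_lt with rfl | hlt
    · exact le_rfl
    · exact (hL'L _ _ hlt).trans (hLL' _)
  have top : ∀ {i i' j j' : W} {m m' : G}, m ∈ M i → m' ∈ M i' →
      k j * m⁻¹ * g i = k j' * m'⁻¹ * g i' → i < i' → j ≤ i' → j' ≤ i' → False := by
    intro i i' j j' m m' hm hm' hc hi hj hj'
    refine hgL' i' ?_
    have : g i' = m' * (k j')⁻¹ * (k j * m⁻¹ * g i) := by rw [hc]; group
    rw [this]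
    exact mul_mem (mul_mem (hM _ hm') (inv_mem (mono hj' (hkL' _)))) (mul_mem (mul_mem
      (mono hj (hkL' _)) (inv_mem (mono hi.le (hM _ hm)))) (hLL' _ (hgL _ _ hi)))
  have b1 := bound hm hm' hc
  have b2 := bound hm' hm hc.symm
  have t1 := top hm hm' hc
  have t2 := top hm' hm hc.symm
  clear bound top mono hLL' hkL hkL' hgL' hL'L hgL hM hm hm' hc
  simp only [imp_false, imp_iff_not_or, not_lt, not_le] at b1 b2 t1 t2
  grind

namespace Ballean

/-- Regularity allows treating one translate `c = j⁻¹i` at a time. -/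
theorem asympDisjoint_of_forall_mk_smul_inter_lt (hr : κ.IsRegular) {A B : Set G}
    (h : ∀ c : G, #((c • A) ∩ B : Set G) < κ) :
    (ofGroup G κ hr.aleph0_le).AsympDisjoint A B := by
  rw [asympDisjoint_ofGroup]
  intro I hI
  have hsub : (I * A) ∩ (I * B) ⊆
      ⋃ p : I × I, p.2.1 • (((p.2.1⁻¹ * p.1.1) • A) ∩ B) := by
    rintro x ⟨⟨i, hi, a, ha, rfl⟩, ⟨j, hj, b, hb, hx⟩⟩
    refine mem_iUnion.2 ⟨(⟨i, hi⟩, ⟨j, hj⟩), b, ⟨⟨a, ha, ?_⟩, hb⟩, hx⟩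
    simp only [smul_eq_mul] at hx ⊢
    rw [mul_assoc, ← hx, inv_mul_cancel_left]
  refine (mk_le_mk_of_subset hsub).trans_lt (hr.mk_iUnion_lt ?_ fun p => ?_)
  · rw [← mul_def]
    exact mul_lt_of_lt hr.aleph0_le hI hI
  · rw [mk_smul_set]
    exact h _

theorem not_isNormal_of_isRegular_of_lt (hr : κ.IsRegular) (hG : κ < #G) :
    ¬ (ofGroup G κ hr.aleph0_le).IsNormal := by
  have hκ := hr.aleph0_le
  obtain ⟨T, hT⟩ := le_mk_iff_exists_set.1 hG.le
  set H := Subgroup.closure T with hHdef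
  have hH : #H = κ := le_antisymm (Subgroup.mk_closure_le hκ hT.le)
    (hT.ge.trans (mk_le_mk_of_subset Subgroup.subset_closure))
  -- Length `κ⁺` lets an index survive when `κ` many elements of `H` each exclude few indices, while
  -- proper initial segments still have size at most `κ`.
  obtain ⟨W, _, _, hWcard, hWlt⟩ := exists_wellOrder_mk_Iio_lt (Order.succ κ)
  have hW : ∀ i : W, #(Iio i) ≤ κ := fun i => Order.lt_succ_iff.1 (hWlt i)
  obtain ⟨k, g, L, L', hHL, hLL', hkL, hkL', hgL', hL'L, hgL⟩ :=
    exists_independent_pairs hκ hG hW H hH.le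
  have hkL₂ : ∀ i j, i < j → k i ∈ L j := fun i j hij => hL'L i j hij (hkL' i)
  have hkinj : Function.Injective k := by
    intro i j hij
    by_contra hne
    rcases lt_or_gt_of_ne hne with h | h
    · exact hkL j (hij ▸ hkL₂ i j h)
    · exact hkL i (hij ▸ hkL₂ j i h)
  have hex : ∀ i, ∃ M ⊆ (fun h => h * k i) '' (H : Set G), #M = κ ∧
      ∀ c : G, #((c • M) ∩ (k '' Iic i) : Set G) < κ := by
    intro i
    refine exists_subset_forall_mk_smul_inter_lt hr (H := H) hH.ge ?_ ?_ ?_ ?_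
    · rw [mk_image_eq (mul_left_injective (k i))]
      exact hH
    · rintro h hh _ ⟨h', hh', rfl⟩
      exact ⟨h * h', mul_mem hh hh', mul_assoc _ _ _⟩
    · intro c hc
      refine (mk_le_mk_of_subset (inter_subset_inter (smul_set_mono (image_subset_range _ _))
        (image_subset_range _ _))).trans_lt (LT.lt.trans_le ?_ hκ)
      exact lt_aleph0_iff_set_finite.2 (finite_smul_range_inter_range hkL hkL₂ hc)
    · refine mk_image_le.trans ?_
      rw [← Iio_insert]
      exact mk_insert_le.trans (add_le_of_le hκ (hW i) (one_le_aleph0.trans hκ))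
  choose M hMsub hMcard hM using hex
  have hML' : ∀ i, M i ⊆ L' i := by
    intro i x hx
    obtain ⟨h, hh, rfl⟩ := hMsub i hx
    exact mul_mem (hLL' i (hHL i hh)) (hkL' i)
  have hdisj : ∀ c : G, #((c • ⋃ i, (g i)⁻¹ • M i) ∩ range k : Set G) < κ := by
    intro c
    have hmem : ∀ y ∈ (c • ⋃ i, (g i)⁻¹ • M i) ∩ range k,
        ∃ i, ∃ m ∈ M i, ∃ j, c * ((g i)⁻¹ * m) = k j ∧ k j = y := by
      rintro _ ⟨⟨_, hx, rfl⟩, ⟨j, hj⟩⟩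
      obtain ⟨i, m, hm, rfl⟩ := mem_iUnion.1 hx
      exact ⟨i, m, hm, j, hj.symm, hj⟩
    by_cases hsub : ((c • ⋃ i, (g i)⁻¹ • M i) ∩ range k).Subsingleton
    · exact (mk_le_one_iff_set_subsingleton.2 hsub).trans_lt (one_lt_aleph0.trans_le hκ)
    rw [not_subsingleton_iff] at hsub
    obtain ⟨y₁, hy₁, y₂, hy₂, hne⟩ := hsub
    obtain ⟨i₁, m₁, hm₁, j₁, h₁, rfl⟩ := hmem _ hy₁
    obtain ⟨i₂, m₂, hm₂, j₂, h₂, rfl⟩ := hmem _ hy₂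
    have key := @index_eq_of_independent_pairs G _ W _ k g L L' M hLL' hkL hkL' hgL' hL'L hgL hML' c
    have h12 := key hm₁ hm₂ h₁ h₂ fun h => hne (h ▸ rfl)
    refine (mk_le_mk_of_subset ?_).trans_lt (hM i₁ (c * (g i₁)⁻¹))
    intro y hy
    obtain ⟨i, m, hm, j, h, rfl⟩ := hmem _ hy
    -- Two distinct points are kept so that any third one can be compared with one of different
    -- `k`-index. Everything then lies in a translate of the single `M i₁` and in `k '' Iic i₁`.
    have hij : i = i₁ ∧ j ≤ i := by
      by_cases hj : j = j₁
      · have h2 := key hm hm₂ h h₂ fun hh => hne (by rw [← hh, hj])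
        exact ⟨h2.1.trans h12.1.symm, h2.2⟩
      · exact key hm hm₁ h h₁ hj
    obtain ⟨rfl, hji⟩ := hij
    exact ⟨⟨m, hm, by rw [← h, ← mul_assoc]; rfl⟩, j, hji, rfl⟩
  intro hnorm
  obtain ⟨U, V, hU, hV, hUV⟩ :=
    hnorm _ _ (asympDisjoint_of_forall_mk_smul_inter_lt hr hdisj)
  rw [isAsympNhd_ofGroup] at hU hV
  have hone : ∀ x : G, #({x} : Set G) < κ := fun x => by
    simpa using one_lt_aleph0.trans_le hκ
  have hbad : #(⋃ h : H, {i | h.1 * k i ∉ V}) ≤ κ := by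
    refine mk_iUnion_le_of_le hκ hH.le fun h => ?_
    refine (mk_le_of_injective (β := (({h.1} * range k) \ V : Set G))
      (f := fun i => ⟨h.1 * k i.1, ⟨_, rfl, _, ⟨_, rfl⟩, rfl⟩, i.2⟩) ?_).trans (hV _ (hone _)).le
    intro i j hij
    exact Subtype.ext (hkinj (mul_left_cancel (Subtype.ext_iff.1 hij)))
  obtain ⟨i, hi⟩ := exists_notMem_of_mk_lt
    (hbad.trans_lt ((Order.lt_succ κ).trans_eq hWcard.symm))
  have hiV : ∀ h ∈ H, h * k i ∈ V := fun h hh => by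
    by_contra hc
    exact hi (mem_iUnion.2 ⟨⟨h, hh⟩, hc⟩)
  obtain ⟨m, hm, hmU⟩ := exists_mem_sdiff_of_mk_lt ((hU _ (hone (g i))).trans_eq (hMcard i).symm)
  obtain ⟨h, hh, rfl⟩ := hMsub i hm
  refine Set.disjoint_left.1 hUV ?_ (hiV h hh)
  by_contra hc
  exact hmU ⟨⟨g i, rfl, _, mem_iUnion.2 ⟨i, _, hm, rfl⟩, by simp⟩, hc⟩

end Ballean

end Regular

/-! ### Finite groups and the final assembly. -/

theorem Ballean.isNormal_ofGroup_of_finite (G : Type*) [Group G] [Finite G] {κ : Cardinal}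
    (hκ : ℵ₀ ≤ κ) : (ofGroup G κ hκ).IsNormal := by
  intro A B _
  have h : ∀ C : Set G, (ofGroup G κ hκ).IsAsympNhd ∅ C := fun C => by
    rw [isAsympNhd_ofGroup]
    exact fun I _ => (lt_aleph0_of_finite _).trans_le hκ
  exact ⟨∅, ∅, h A, h B, disjoint_bot_left⟩

theorem theorem1p14 (G : Type*) [Group G] :
    (∀ (κ : Cardinal) (hκ : Cardinal.aleph0 ≤ κ), κ ≤ Cardinal.mk G →
      List.TFAE [
        Ballean.HasLinearlyOrderedBase (Ballean.ofGroup G κ hκ).entourages,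
        Ballean.HasLinearlyOrderedBase (Ballean.ofGroup G κ hκ).bornology,
        (Ballean.ofGroup G κ hκ).HasBoundedGrowth,
        Cardinal.mk G = κ ∧ κ.IsRegular] ∧
      (κ.IsRegular ∨ Group.IsSolvable G →
        List.TFAE [
          Ballean.HasLinearlyOrderedBase (Ballean.ofGroup G κ hκ).entourages,
          Ballean.HasLinearlyOrderedBase (Ballean.ofGroup G κ hκ).bornology,
          (Ballean.ofGroup G κ hκ).HasBoundedGrowth,
          Cardinal.mk G = κ ∧ κ.IsRegular,
          (Ballean.ofGroup G κ hκ).IsNormal])) ∧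
    ((Ballean.ofGroup G Cardinal.aleph0 le_rfl).IsNormal ↔ Countable G) := by

  have main : ∀ (κ : Cardinal) (hκ : ℵ₀ ≤ κ), κ ≤ #G → List.TFAE [
      Ballean.HasLinearlyOrderedBase (Ballean.ofGroup G κ hκ).entourages,
      Ballean.HasLinearlyOrderedBase (Ballean.ofGroup G κ hκ).bornology,
      (Ballean.ofGroup G κ hκ).HasBoundedGrowth,
      #G = κ ∧ κ.IsRegular] := by
    intro κ hκ hG
    rw [Ballean.bornology_ofGroup]
    tfae_have 1 ↔ 2 := Ballean.hasLinearlyOrderedBase_entourages_iff hκ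
    tfae_have 2 → 4 := fun h => by
      obtain rfl := Ballean.mk_eq_of_hasLinearlyOrderedBase hκ hG h
      exact ⟨rfl, Ballean.isRegular_of_hasLinearlyOrderedBase hκ h⟩
    tfae_have 4 → 2 := by
      rintro ⟨rfl, hr⟩
      exact Ballean.hasLinearlyOrderedBase_of_isRegular hr
    tfae_have 3 → 4 := Ballean.mk_eq_and_isRegular_of_hasBoundedGrowth hκ hG
    tfae_have 4 → 3 := fun h => Ballean.hasBoundedGrowth_of_isRegular hκ h.1 h.2
    tfae_finish
  have normal : ∀ (κ : Cardinal) (hκ : ℵ₀ ≤ κ), κ ≤ #G → (κ.IsRegular ∨ Group.IsSolvable G) →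
      ((#G = κ ∧ κ.IsRegular) ↔ (Ballean.ofGroup G κ hκ).IsNormal) := by
    intro κ hκ hG hor
    constructor
    · rintro ⟨rfl, hr⟩
      exact Ballean.isNormal_of_hasLinearlyOrderedBase hκ
        (Ballean.hasLinearlyOrderedBase_of_isRegular hr)
    · intro hn
      have hr : κ.IsRegular := by
        by_contra hr
        have := hor.resolve_left hr
        exact Ballean.not_isNormal_of_isSolvable hκ hG hr hn
      refine ⟨hG.antisymm' ?_, hr⟩
      by_contra! hlt
      exact Ballean.not_isNormal_of_isRegular_of_lt hr hlt hn
  refine ⟨fun κ hκ hG => ⟨main κ hκ hG, fun hor => ?_⟩, ?_⟩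
  · have h1 := (main κ hκ hG).out 0 3
    have h2 := (main κ hκ hG).out 1 3
    have h3 := (main κ hκ hG).out 2 3
    have h4 := normal κ hκ hG hor
    tfae_have 1 ↔ 4 := h1
    tfae_have 2 ↔ 4 := h2
    tfae_have 3 ↔ 4 := h3
    tfae_have 4 ↔ 5 := h4
    tfae_finish
  -- A finite `G` violates `ℵ₀ ≤ #G`, so it is treated apart: there every set is bounded and `∅` is
  -- an asymptotic neighborhood of anything.
  · cases finite_or_infinite G
    · exact iff_of_true (Ballean.isNormal_ofGroup_of_finite G le_rfl) inferInstance
    · rw [← normal ℵ₀ le_rfl (aleph0_le_mk G) (Or.inl isRegular_aleph0), ← mk_le_aleph0_iff]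
      exact ⟨fun h => h.1.le, fun h => ⟨h.antisymm (aleph0_le_mk G), isRegular_aleph0⟩⟩
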